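/- **Setting.** Fix $k\ge 1$, let $[m]=\{1,\dots,m\}$ and let $f:[m]^k\to\{0,1\}$. There are $k$ players; player $i$ receives $x_i\in[m]$ in a register in state $|x_i\rangle$ and has a finite-dimensional local Hilbert space, on which he can perform local quantum operations (adjoining ancillas included). At the end of a protocol each player holds an output qubit, and all output qubits are projected onto $|1\cdots 1\rangle$; the output is $0$ if the resulting vector is zero and $1$ otherwise. A protocol *nondeterministically computes* $f$ if for every $x\in[m]^k$ the probability of obtaining $|1\cdots1\rangle$ is nonzero if $f(x)=1$ and is zero if $f(x)=0$. * $\mathrm{NQ}(f)$ is the minimum of $\log_2 r$ over all integers $r\ge1$ for which there is a protocol that starts in the state $|x_1\cdots x_k\rangle\otimes\sum_{a=1}^r|a\rangle^{\otimes k}$ (each player holding one share of the unnormalised GHZ state of rank $r$), uses local quantum operations only, and nondeterministically computes $f$. * $\mathrm{NQ}_0(f)$ is the minimum of the total number of qubits sent over all protocols that start in the state $|x_1\cdots x_k\rangle$ without preshared entanglement, alternate local quantum operations with predetermined rounds in which one player sends one qubit to one other player, and nondeterministically compute $f$. **Theorem (asymptotic upper bound).** Let $k\ge1$ be an integer. For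 every real $\varepsilon>0$ there is an $n_0$ such that for all positive integers $m$ and all $f:[m]^k\to\{0,1\}$ with $\mathrm{NQ}(f)>n_0$, $$\mathrm{NQ}_0(f)\le\frac{k+\varepsilon}{2}\,\mathrm{NQ}(f).$$ -/

import Mathlib

open scoped Matrix BigOperators

namespace QComm

/-- A (not necessarily normalised) pure state of `k` players, the `i`-th of which has the
finite-dimensional Hilbert space with orthonormal basis `B i`: the family of amplitudes of a
vector in the tensor product of the `k` local spaces. -/
abbrev JointState {k : ℕ} (B : Fin k → Type) : Type := (∀ i, B i) → ℂ

/-- The product basis vector `|x₁ ⋯ x_k⟩`. -/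
def basisState {k : ℕ} {B : Fin k → Type} [∀ i, DecidableEq (B i)] (x : ∀ i, B i) :
    JointState B :=
  fun b => if b = x then 1 else 0

/-- The state `∑ₐ |a⟩|a⟩⋯|a⟩`, the sum being over `r` values of `a` (GHZ state of rank `r`). -/
def ghz (k r : ℕ) : JointState (fun _ : Fin k => Fin r) :=
  ∑ a : Fin r, basisState (fun _ => a)

/-- `|x₁ ⋯ x_k⟩|GHZ_r⟩`: player `i` holds the input register `|x_i⟩` and a share of the
GHZ state. -/
def inputGHZ {k m : ℕ} (r : ℕ) (x : Fin k → Fin m) :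
    JointState (fun _ : Fin k => Fin m × Fin r) :=
  fun b => basisState (B := fun _ => Fin m) x (fun i => (b i).1) * ghz k r (fun i => (b i).2)

/-- `V` is the matrix of an isometry. Local quantum operations are taken in purified form: an
isometry into a possibly larger space adjoins ancillas and applies a unitary, while measurement
records and discarded systems stay in the work space of the player (Stinespring). -/
def IsIsometry {B C : Type} [Fintype C] [DecidableEq B] (V : Matrix C B ℂ) : Prop :=
  Vᴴ * V = 1

/-- The local operation `V₁ ⊗ ⋯ ⊗ V_k` applied to a joint state. -/
def applyLocal {k : ℕ} {B C : Fin k → Type} [∀ i, Fintype (B i)]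
    (V : ∀ i, Matrix (C i) (B i) ℂ) (ψ : JointState B) : JointState C :=
  fun c => ∑ b : (∀ i, B i), (∏ i, V i (c i) (b i)) * ψ b

/-- Player `i` has an output qubit `R_i` and a work space with basis `W i`. This is the vector on
the work spaces left by the projection of the output qubits onto `|1 ⋯ 1⟩`. The probability
that the output is `1` is its squared norm, divided by that of `φ`. -/
def projOnes {k : ℕ} {W : Fin k → Type} (φ : JointState (fun i => Fin 2 × W i)) :
    JointState W :=
  fun w => φ (fun i => (1, w i))

/-- `φ x` being the final state on input `x`: the probability of output `1` is nonzero if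
`f x = 1`, and it is zero if `f x = 0`. -/
def NondetComputes {k m : ℕ} {W : Fin k → Type}
    (φ : (Fin k → Fin m) → JointState (fun i => Fin 2 × W i))
    (f : (Fin k → Fin m) → Bool) : Prop :=
  (∀ x, f x = true → projOnes (φ x) ≠ 0) ∧ (∀ x, f x = false → projOnes (φ x) = 0)

/-- Some protocol that starts with a shared GHZ state of rank `r` and consists of local quantum
operations only computes `f` nondeterministically. -/
def GHZComputable {k m : ℕ} (r : ℕ) (f : (Fin k → Fin m) → Bool) : Prop :=
  ∃ (W : Fin k → Type) (_ : ∀ i, Fintype (W i))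
    (V : ∀ i, Matrix (Fin 2 × W i) (Fin m × Fin r) ℂ),
    (∀ i, IsIsometry (V i)) ∧ NondetComputes (fun x => applyLocal V (inputGHZ r x)) f

/-- `NQ(f)`: the minimum of `log₂ r` over the ranks `r ≥ 1` of the GHZ states with which `f` can
be computed nondeterministically. -/
noncomputable def NQ {k m : ℕ} (f : (Fin k → Fin m) → Bool) : ℝ :=
  Real.logb 2 (sInf {r : ℕ | 1 ≤ r ∧ GHZComputable r f} : ℕ)

/-- The local spaces with bases `C i`, together with one qubit in the possession of player `s`:
`i = s → Fin 2` is the basis of a qubit for `i = s`, and has one element for `i ≠ s`. -/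
abbrev WithQubit {k : ℕ} (C : Fin k → Type) (s : Fin k) : Fin k → Type :=
  fun i => C i × (i = s → Fin 2)

/-- Player `s` hands the qubit over to player `t`. -/
def passQubit {k : ℕ} {C : Fin k → Type} (s t : Fin k) (ψ : JointState (WithQubit C s)) :
    JointState (WithQubit C t) :=
  fun b => ψ (fun i => ((b i).1, fun _ => (b t).2 rfl))

/-- `MessagePassing n B ψ`: some message-passing protocol without preshared entanglement, in
which `n` qubits are sent, brings the players into the state `ψ x` on every input `x`. Player `i`
starts with `|x_i⟩`. What the players do depends on the input through their registers only. -/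
inductive MessagePassing {k m : ℕ} :
    ℕ → (B : Fin k → Type) → ((Fin k → Fin m) → JointState B) → Prop
  | init : MessagePassing 0 (fun _ => Fin m) (fun x => basisState x)
  | localOps {n : ℕ} {B C : Fin k → Type} {ψ : (Fin k → Fin m) → JointState B}
      [∀ i, Fintype (B i)] [∀ i, DecidableEq (B i)] [∀ i, Fintype (C i)]
      (V : ∀ i, Matrix (C i) (B i) ℂ) (hV : ∀ i, IsIsometry (V i))
      (h : MessagePassing n B ψ) :
      MessagePassing n C (fun x => applyLocal V (ψ x))
  | send {n : ℕ} {C : Fin k → Type} (s t : Fin k) (hst : s ≠ t)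
      {ψ : (Fin k → Fin m) → JointState (WithQubit C s)}
      (h : MessagePassing n (WithQubit C s) ψ) :
      MessagePassing (n + 1) (WithQubit C t) (fun x => passQubit s t (ψ x))

/-- Some message-passing protocol without preshared entanglement, in which `n` qubits are sent,
computes `f` nondeterministically. -/
def MessageComputable {k m : ℕ} (n : ℕ) (f : (Fin k → Fin m) → Bool) : Prop :=
  ∃ (W : Fin k → Type) (φ : (Fin k → Fin m) → JointState (fun i => Fin 2 × W i)),
    MessagePassing n (fun i => Fin 2 × W i) φ ∧ NondetComputes φ f

/-- `NQ₀(f)`: the minimal number of qubits sent in a message-passing protocol without preshared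
entanglement that computes `f` nondeterministically. -/
noncomputable def NQ₀ {k m : ℕ} (f : (Fin k → Fin m) → Bool) : ℕ :=
  sInf {n : ℕ | MessageComputable n f}

/-! The two minima are over nonempty sets. -/

/-- The matrix of the map `|b⟩ ↦ |p b⟩`. -/
def basisMap {B C : Type} [DecidableEq C] (p : B → C) : Matrix C B ℂ :=
  fun c b => if c = p b then 1 else 0

theorem basisMap_isIsometry {B C : Type} [Fintype C] [DecidableEq B] [DecidableEq C] {p : B → C}
    (hp : Function.Injective p) : IsIsometry (basisMap p) := by
  unfold IsIsometry
  ext b b'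
  simp [Matrix.mul_apply, basisMap, Matrix.one_apply, hp.eq_iff, eq_comm]

theorem applyLocal_basisState {k : ℕ} {B C : Fin k → Type} [∀ i, Fintype (B i)]
    [∀ i, DecidableEq (B i)] [∀ i, DecidableEq (C i)] (p : ∀ i, B i → C i) (x : ∀ i, B i) :
    applyLocal (fun i => basisMap (p i)) (basisState x) = basisState (fun i => p i (x i)) := by
  funext c
  simp only [applyLocal, basisState, mul_ite, mul_one, mul_zero, Finset.sum_ite_eq',
    Finset.mem_univ, if_true, basisMap, Finset.prod_ite_zero, Finset.prod_const_one, true_imp_iff]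
  congr 1
  simp [funext_iff]

theorem projOnes_basisState {k : ℕ} {W : Fin k → Type} [∀ i, DecidableEq (W i)]
    (y : ∀ i, Fin 2 × W i) :
    projOnes (basisState (B := fun i => Fin 2 × W i) y) ≠ 0 ↔ ∀ i, (y i).1 = 1 := by
  constructor
  · intro h i
    by_contra hi
    apply h
    funext w
    simp only [projOnes, basisState, Pi.zero_apply, ite_eq_right_iff, one_ne_zero, imp_false]
    intro e
    exact hi (by rw [← e])
  · intro h e
    have := congrFun e (fun i => (y i).2)
    simp only [projOnes, basisState, Pi.zero_apply, ite_eq_right_iff, one_ne_zero,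
      imp_false] at this
    exact this (by funext i; exact Prod.ext (h i).symm rfl)

theorem applyLocal_sum {k : ℕ} {B C : Fin k → Type} [∀ i, Fintype (B i)] {ι : Type} [Fintype ι]
    (V : ∀ i, Matrix (C i) (B i) ℂ) (ψ : ι → JointState B) :
    applyLocal V (∑ a, ψ a) = ∑ a, applyLocal V (ψ a) := by
  funext c
  simp only [applyLocal, Finset.sum_apply, Finset.mul_sum]
  exact Finset.sum_comm

theorem inputGHZ_eq_sum {k m r : ℕ} (x : Fin k → Fin m) :
    inputGHZ r x = ∑ a : Fin r, basisState (fun i => (x i, a)) := by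
  funext b
  simp only [inputGHZ, ghz, Finset.sum_apply, basisState, Finset.mul_sum]
  refine Finset.sum_congr rfl fun a _ => ?_
  simp only [funext_iff, Prod.ext_iff, forall_and, mul_ite, mul_one, mul_zero]
  split_ifs <;> simp_all

/-- Some GHZ state suffices for `f`, so that the minimum in `NQ` exists. -/
theorem exists_GHZComputable {k m : ℕ} (hk : 1 ≤ k) (f : (Fin k → Fin m) → Bool) :
    {r : ℕ | 1 ≤ r ∧ GHZComputable r f}.Nonempty := by
  classical
  let z : Fin k := ⟨0, hk⟩
  let E := Fintype.equivFin (Option (Fin k → Fin m))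
  let bit : ∀ i : Fin k, Fin m × Fin (Fintype.card (Option (Fin k → Fin m))) → Fin 2 :=
    fun i b => if ∃ u, E.symm b.2 = some u ∧ u i = b.1 ∧ f u = true then 1 else 0
  let Q : ∀ i : Fin k, Fin m × Fin (Fintype.card (Option (Fin k → Fin m))) →
      Fin 2 × (Fin m × Fin (Fintype.card (Option (Fin k → Fin m)))) := fun i b => (bit i b, b)
  have hQ : ∀ i, Function.Injective (Q i) := fun i a b h => congrArg Prod.snd h
  have hval : ∀ (x : Fin k → Fin m) w,
      projOnes (applyLocal (fun i => basisMap (Q i)) (inputGHZ _ x)) w =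
        ∑ a, if (fun i => ((1 : Fin 2), w i)) = fun i => Q i (x i, a) then (1 : ℂ) else 0 := by
    intro x w
    rw [inputGHZ_eq_sum, applyLocal_sum]
    simp only [applyLocal_basisState, projOnes, Finset.sum_apply, basisState]
  refine ⟨Fintype.card (Option (Fin k → Fin m)), Fintype.card_pos, fun _ => _, fun _ => _,
    fun i => basisMap (Q i), fun i => basisMap_isIsometry (hQ i), fun x hx h => ?_,
    fun x hx => ?_⟩
  · have h0 := congrFun h (fun i => (x i, E (some x)))
    rw [hval, Finset.sum_eq_single (E (some x))] at h0
    · rw [if_pos] at h0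
      · simp at h0
      · funext i
        simp only [Q, bit, Equiv.symm_apply_apply, Option.some.injEq]
        rw [if_pos ⟨x, rfl, rfl, hx⟩]
    · intro a _ ha
      rw [if_neg]
      intro e
      exact ha (congrArg (fun y => y.2.2) (congrFun e z)).symm
    · simp
  · funext w
    rw [hval]
    refine Finset.sum_eq_zero fun a _ => if_neg fun e => ?_
    have hb : ∀ i, ∃ u, E.symm a = some u ∧ u i = x i ∧ f u = true := by
      intro i
      have := congrArg Prod.fst (congrFun e i)
      by_contra hne
      simp only [Q, bit] at this
      rw [if_neg hne] at this
      exact absurd this (by decide)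
    obtain ⟨u, hu, -, hfu⟩ := hb z
    have hux : u = x := by
      funext i
      obtain ⟨v, hv, hvi, -⟩ := hb i
      rw [hu, Option.some.injEq] at hv
      rw [hv, hvi]
    rw [hux, hx] at hfu
    exact absurd hfu (by simp)

/-- Some message-passing protocol computes `f`, so that the minimum in `NQ₀` exists. -/
theorem exists_MessageComputable {k m : ℕ} (hk : 1 ≤ k) (f : (Fin k → Fin m) → Bool) :
    {n : ℕ | MessageComputable n f}.Nonempty := by
  classical
  let z : Fin k := ⟨0, hk⟩
  have key : ∀ T : Finset (Fin k × (Fin m → Fin 2)),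
      ∃ (n : ℕ) (B : Fin k → Type) (_ : ∀ i, Fintype (B i)) (g : (Fin k → Fin m) → ∀ i, B i),
        MessagePassing n B (fun x => basisState (g x)) ∧
        (∃ e : ∀ i, B i → Fin m, ∀ x i, e i (g x i) = x i) ∧
        ∀ p ∈ T, ∃ d : B z → Fin 2, ∀ x, d (g x z) = p.2 (x p.1) := by
    intro T
    induction T using Finset.induction_on with
    | empty =>
      refine ⟨0, fun _ => Fin m, inferInstance, fun x => x, ?_, ⟨fun _ b => b, fun _ _ => rfl⟩,
        by simp⟩
      convert MessagePassing.init
    | insert p T hp ih =>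
      obtain ⟨n, B, hB, g, hg, ⟨e, he⟩, hd⟩ := ih
      by_cases hs : p.1 = z
      · refine ⟨n, B, hB, g, hg, ⟨e, he⟩, ?_⟩
        intro q hq
        rcases Finset.mem_insert.1 hq with rfl | hq
        · exact ⟨fun b => q.2 (e z b), fun x => by simp only [he, hs]⟩
        · exact hd q hq
      · let P : ∀ i, B i → WithQubit B p.1 i := fun i b => (b, fun _ => p.2 (e i b))
        have hP : ∀ i, Function.Injective (P i) := fun i a b h => congrArg Prod.fst h
        have h1 := MessagePassing.localOps (fun i => basisMap (P i))
          (fun i => basisMap_isIsometry (hP i)) hg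
        have h2 := MessagePassing.send p.1 z hs h1
        refine ⟨n + 1, WithQubit B z, inferInstance,
          fun x i => (g x i, fun _ => p.2 (x p.1)), ?_, ⟨fun i b => e i b.1, fun x i => he x i⟩, ?_⟩
        · convert h2 using 2 with x
          rw [applyLocal_basisState]
          funext b
          simp only [passQubit, basisState]
          congr 1
          apply propext
          constructor
          · rintro rfl
            funext i
            refine Prod.ext rfl ?_
            funext hi
            subst hi
            simp [P, he]
          · intro h
            funext i
            have hi := congrFun h i
            refine Prod.ext (show (b i).1 = g x i from congrArg Prod.fst hi) ?_
            funext hz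
            subst hz
            have hb := congrFun h p.1
            have := congrFun (congrArg Prod.snd hb) rfl
            simpa [P, he] using this
        · intro q hq
          rcases Finset.mem_insert.1 hq with rfl | hq
          · exact ⟨fun b => b.2 rfl, fun x => rfl⟩
          · obtain ⟨d, hd⟩ := hd q hq
            exact ⟨fun b => d b.1, hd⟩
  obtain ⟨n, B, hB, g, hg, -, hd⟩ := key Finset.univ
  have hinj : ∀ x y, g x z = g y z → x = y := by
    intro x y h
    funext i
    obtain ⟨d, hd⟩ := hd (i, fun a => if a = x i then 1 else 0) (Finset.mem_univ _)
    have h1 := hd x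
    have h2 := hd y
    rw [h, h2] at h1
    by_contra hne
    simp [Ne.symm hne] at h1
  let Q : ∀ i, B i → Fin 2 × B i := fun i b =>
    (if ∃ y, g y i = b ∧ (i = z → f y = true) then 1 else 0, b)
  have hQ : ∀ i, Function.Injective (Q i) := fun i a b h => congrArg Prod.snd h
  have h1 := MessagePassing.localOps (fun i => basisMap (Q i))
    (fun i => basisMap_isIsometry (hQ i)) hg
  have hacc : ∀ x, projOnes (applyLocal (fun i => basisMap (Q i)) (basisState (g x))) ≠ 0 ↔
      f x = true := by
    intro x
    rw [applyLocal_basisState, projOnes_basisState]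
    constructor
    · intro h
      have := h z
      simp only [Q, ite_eq_left_iff, zero_ne_one, imp_false, not_not] at this
      obtain ⟨y, hy, hf⟩ := this
      rw [← hinj y x hy]
      exact hf trivial
    · intro h i
      simp only [Q, ite_eq_left_iff, zero_ne_one, imp_false, not_not]
      exact ⟨x, rfl, fun _ => h⟩
  refine ⟨n, B, _, h1, fun x hx => (hacc x).2 hx, fun x hx => ?_⟩
  by_contra h
  rw [(hacc x).1 h] at hx
  exact absurd hx (by simp)

end QComm

/-!
A GHZ state of rank `r` can be replaced by about `k / 2 * log₂ r` qubits of communication, so that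
a GHZ protocol for `f` becomes a message-passing protocol.

For `k ≥ 2` the players sit in a cycle, and neighbours share maximally entangled qubits, which costs one
sent qubit per pair (`exists_messagePassing_view`). The qubits between two neighbours hold a
superposition of labels, which are vectors in `{0, …, 2 ^ (p + k) - 1} ^ D`; each player sees two
adjacent labels of a cyclic sequence `z₀, …, z_{k-1}`. Since a protocol is only required to
succeed with nonzero probability, every player may project onto a set of pairs of his choice. If
the sequences that pass all these projections form a family of `r` sequences in which each player
can tell from his two labels which member of the family he sees, then what is left is a GHZ
state of rank `r` (`messageComputable_of_locally_closed`).

Such a family is given by `z₀ = u`, `z_i = v + (i - 1) u`, where the pairs `(u, v)` have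
prescribed `|u|² = c` and `⟨u, v⟩ = e`. A sequence that passes the projections has
`|z_{i+1} - z_i|² = c` for `1 ≤ i ≤ k - 2`, as well as `⟨z₀, z₁⟩ = e` and
`⟨z₀, z_{k-1}⟩ = e + (k - 2) c`. As the mixed terms telescope,
`∑ |z_{i+1} - z_i - z₀|² = 2 (k - 2) c - 2 ⟨z₀, z_{k-1} - z₁⟩ = 0`,
so it is of the given form (`exists_eq_progression`). By the pigeonhole principle, with entries of
`u` and `v` below `2 ^ p`, some choice of `c` and `e` leaves at least
`4 ^ (p D) / ((D + 1) 4 ^ p) ^ 2` pairs (`exists_pairs_with_equal_products`). The cost is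
`k D (p + k)` qubits, and `log₂ r` is about `2 p D`; for `p` large and `D → ∞` the ratio tends to
`k / 2` (`exists_parameters`). A single player needs no communication
(`messageComputable_zero_of_one_player`).
-/

namespace QComm

/-! ### Maximally entangled qubits on the edges of a graph -/

theorem applyLocal_smul {k : ℕ} {B C : Fin k → Type} [∀ i, Fintype (B i)]
    (V : ∀ i, Matrix (C i) (B i) ℂ) (c : ℂ) (ψ : JointState B) :
    applyLocal V (c • ψ) = c • applyLocal V ψ := by
  funext b
  simp only [applyLocal, Pi.smul_apply, smul_eq_mul, Finset.mul_sum]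
  exact Finset.sum_congr rfl fun _ _ => mul_left_comm _ _ _

theorem applyLocal_basisState_apply {k : ℕ} {B C : Fin k → Type} [∀ i, Fintype (B i)]
    [∀ i, DecidableEq (B i)] (V : ∀ i, Matrix (C i) (B i) ℂ) (b : ∀ i, B i) (c : ∀ i, C i) :
    applyLocal V (basisState b) c = ∏ i, V i (c i) (b i) := by
  simp [applyLocal, basisState]

/-- The matrix of `|b⟩ ↦ |D|^(-1/2) ∑ d, |b, d, d⟩`, which adjoins a maximally entangled pair. -/
noncomputable def adjoinPair (B D : Type) [Fintype D] [DecidableEq B] [DecidableEq D] :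
    Matrix ((B × D) × D) B ℂ :=
  fun c b => if c.1.1 = b ∧ c.1.2 = c.2 then ((√(Fintype.card D : ℝ) : ℝ) : ℂ)⁻¹ else 0

theorem adjoinPair_isIsometry (B D : Type) [Fintype B] [Fintype D] [DecidableEq B]
    [DecidableEq D] [Nonempty D] : IsIsometry (adjoinPair B D) := by
  unfold IsIsometry
  ext b b'
  have hD : ((√(Fintype.card D : ℝ) : ℝ) : ℂ) * ((√(Fintype.card D : ℝ) : ℝ) : ℂ) =
      (Fintype.card D : ℂ) := by
    rw [← Complex.ofReal_mul, Real.mul_self_sqrt (Nat.cast_nonneg _), Complex.ofReal_natCast]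
  have hD0 : (Fintype.card D : ℂ) ≠ 0 := Nat.cast_ne_zero.2 Fintype.card_ne_zero
  rw [Matrix.mul_apply, Matrix.one_apply, Fintype.sum_prod_type, Fintype.sum_prod_type]
  simp only [Matrix.conjTranspose_apply, adjoinPair]
  have h : ∀ (a : B) (d d' : D),
      star (if a = b ∧ d = d' then ((√(Fintype.card D : ℝ) : ℝ) : ℂ)⁻¹ else 0) *
        (if a = b' ∧ d = d' then ((√(Fintype.card D : ℝ) : ℝ) : ℂ)⁻¹ else 0) =
      if d = d' then (if a = b then (if b = b' then (Fintype.card D : ℂ)⁻¹ else 0) else 0)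
        else 0 := by
    intro a d d'
    by_cases h1 : a = b
    · subst h1
      by_cases h2 : d = d' <;> by_cases h3 : a = b' <;> simp [h2, h3, ← mul_inv, hD]
    · simp [h1]
  simp only [h, Finset.sum_ite_eq, Finset.mem_univ, if_true, Finset.sum_const, Finset.card_univ]
  by_cases hb : b = b' <;> simp [hb, hD0]

/-- Player `s` prepares a maximally entangled pair of qubits and hands one half to player `t`. -/
theorem passQubit_adjoinPair {k : ℕ} {B : Fin k → Type} [∀ i, Fintype (B i)]
    [∀ i, DecidableEq (B i)] (s t : Fin k) :
    ∃ w : ℂ, w ≠ 0 ∧ ∀ b : ∀ i, B i,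
      passQubit (C := WithQubit B s) s t
        (applyLocal (fun i => adjoinPair (B i) (i = s → Fin 2)) (basisState b)) =
      w • ∑ j : Fin 2, basisState (B := WithQubit (WithQubit B s) t)
        (fun i => ((b i, fun _ => j), fun _ => j)) := by
  refine ⟨∏ i : Fin k, ((√(Fintype.card (i = s → Fin 2) : ℝ) : ℝ) : ℂ)⁻¹, ?_, fun b => ?_⟩
  · refine Finset.prod_ne_zero_iff.2 fun i _ => inv_ne_zero ?_
    rw [Complex.ofReal_ne_zero, Real.sqrt_ne_zero']
    exact_mod_cast Fintype.card_pos
  · funext c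
    simp only [passQubit, applyLocal_basisState_apply, adjoinPair, Pi.smul_apply,
      Finset.sum_apply, smul_eq_mul]
    rw [Finset.sum_eq_single ((c t).2 rfl)]
    · rw [Finset.prod_ite_zero]
      simp only [Finset.mem_univ, true_imp_iff, basisState, mul_ite, mul_one, mul_zero]
      refine if_congr ?_ rfl rfl
      constructor
      · intro h
        funext i
        refine Prod.ext (Prod.ext (h i).1 (h i).2) ?_
        funext hi
        subst hi
        rfl
      · intro h i
        exact ⟨congrArg (fun y => y.1.1) (congrFun h i), congrArg (fun y => y.1.2) (congrFun h i)⟩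
    · intro j _ hj
      refine if_neg fun h => hj ?_
      exact (congrFun (congrArg Prod.snd (congrFun h t)) rfl).symm
    · simp

/-- What player `i` sees of the bits `y`, where the bit `y e` is known to the players `s e` and
`t e` only. -/
def view {k : ℕ} {E : Type} (s t : E → Fin k) (i : Fin k) (y : E → Fin 2) : E → Option (Fin 2) :=
  fun e => if s e = i ∨ t e = i then some (y e) else none

theorem view_eq_iff {k : ℕ} {E : Type} {s t : E → Fin k} {i : Fin k} {y z : E → Fin 2} :
    view s t i y = view s t i z ↔ ∀ e, s e = i ∨ t e = i → y e = z e := by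
  simp only [view, funext_iff]
  refine forall_congr' fun e => ?_
  by_cases h : s e = i ∨ t e = i <;> simp [h]

open Classical in
/-- Sending one qubit along each edge `e` from `s e` to `t e`, the players can share a maximally
entangled pair of qubits on each edge. -/
theorem exists_messagePassing_view {k m : ℕ} (E : Type) [Fintype E] (s t : E → Fin k)
    (hst : ∀ e, s e ≠ t e) :
    ∃ c : ℂ, c ≠ 0 ∧ MessagePassing (Fintype.card E)
      (fun _ : Fin k => Fin m × (E → Option (Fin 2)))
      (fun x => c • ∑ y : E → Fin 2, basisState (fun i => (x i, view s t i y))) := by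
  revert s t hst
  refine Fintype.induction_empty_option (P := fun E _ => ∀ s t : E → Fin k, (∀ e, s e ≠ t e) →
    ∃ c : ℂ, c ≠ 0 ∧ MessagePassing (Fintype.card E)
      (fun _ : Fin k => Fin m × (E → Option (Fin 2)))
      (fun x => c • ∑ y : E → Fin 2, basisState (fun i => (x i, view s t i y)))) ?_ ?_ ?_ E
  · intro α β _ e ih s t hst
    let _ : Fintype α := Fintype.ofEquiv β e.symm
    obtain ⟨c, hc, h⟩ := ih (s ∘ e) (t ∘ e) (fun a => hst _)
    refine ⟨c, hc, ?_⟩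
    have hP : Function.Injective (fun b : Fin m × (α → Option (Fin 2)) => (b.1, b.2 ∘ e.symm)) :=
      fun b b' hb => Prod.ext (congrArg (fun y => y.1) hb)
        (e.symm.surjective.injective_comp_right (congrArg (fun y => y.2) hb))
    have h1 := MessagePassing.localOps (fun _ => basisMap _)
      (fun _ : Fin k => basisMap_isIsometry hP) h
    rw [← Fintype.card_congr e]
    convert h1 using 2 with x
    rw [applyLocal_smul, applyLocal_sum, ← (e.arrowCongr (Equiv.refl (Fin 2))).sum_comp]
    congr 1
    refine Finset.sum_congr rfl fun y _ => ?_
    rw [applyLocal_basisState]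
    congr 1
    funext i
    refine Prod.ext rfl ?_
    funext b
    simp [view]
  · intro s t hst
    refine ⟨1, one_ne_zero, ?_⟩
    have hP : Function.Injective
        (fun b : Fin m => ((b, fun e => e.elim) : Fin m × (PEmpty.{1} → Option (Fin 2)))) :=
      fun b b' hb => congrArg (fun y => y.1) hb
    have h1 := MessagePassing.localOps (fun _ => basisMap _)
      (fun _ : Fin k => basisMap_isIsometry hP) (MessagePassing.init (k := k) (m := m))
    rw [Fintype.card_eq_zero]
    convert h1 using 2 with x
    rw [applyLocal_basisState, one_smul, Fintype.sum_unique]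
    congr 1
    funext i
    exact Prod.ext rfl (Subsingleton.elim _ _)
  · intro α _ ih s t hst
    obtain ⟨c, hc, h⟩ := ih (fun a => s (some a)) (fun a => t (some a)) (fun a => hst _)
    obtain ⟨w, hw, hpass⟩ := passQubit_adjoinPair
      (B := fun _ : Fin k => Fin m × (α → Option (Fin 2))) (s none) (t none)
    refine ⟨c * w, mul_ne_zero hc hw, ?_⟩
    -- `P` files the two halves of the new pair under the edge `none`
    let P : ∀ i, WithQubit (WithQubit (fun _ : Fin k => Fin m × (α → Option (Fin 2))) (s none))
        (t none) i → Fin m × (Option α → Option (Fin 2)) := fun i b =>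
      (b.1.1.1, fun o => o.elim (if hs : i = s none then some (b.1.2 hs) else
        if ht : i = t none then some (b.2 ht) else none) b.1.1.2)
    have hP : ∀ i, Function.Injective (P i) := by
      intro i b b' hb
      have h0 : ∀ o, (P i b).2 o = (P i b').2 o := fun o => by rw [hb]
      refine Prod.ext (Prod.ext (Prod.ext (congrArg (fun y => y.1) hb) ?_) ?_) ?_
      · funext a
        exact h0 (some a)
      · funext hs
        have := h0 none
        simpa only [P, Option.elim_none, dif_pos hs, Option.some.injEq] using this
      · funext ht
        have hs : i ≠ s none := fun hs => hst none (hs.symm.trans ht)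
        have := h0 none
        simpa only [P, Option.elim_none, dif_neg hs, dif_pos ht, Option.some.injEq] using this
    have h1 := MessagePassing.localOps
      (fun i => adjoinPair (Fin m × (α → Option (Fin 2))) (i = s none → Fin 2))
      (fun i => adjoinPair_isIsometry _ _) h
    have h2 := MessagePassing.send (C := WithQubit _ (s none)) (s none) (t none) (hst none) h1
    have h3 := MessagePassing.localOps (fun i => basisMap (P i))
      (fun i => basisMap_isIsometry (hP i)) h2
    rw [Fintype.card_option]
    convert h3 using 2 with x
    have hlin : passQubit (C := WithQubit (fun _ : Fin k => Fin m × (α → Option (Fin 2))) (s none))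
        (s none) (t none)
        (applyLocal (fun i => adjoinPair (Fin m × (α → Option (Fin 2))) (i = s none → Fin 2))
          (c • ∑ y : α → Fin 2, basisState
            (fun i => (x i, view (fun a => s (some a)) (fun a => t (some a)) i y)))) =
        (c * w) • ∑ y : α → Fin 2, ∑ j : Fin 2, basisState (fun i =>
          (((x i, view (fun a => s (some a)) (fun a => t (some a)) i y), fun _ => j),
            fun _ => j)) := by
      rw [applyLocal_smul, applyLocal_sum, mul_smul, Finset.smul_sum (r := w)]
      simp only [← hpass]
      funext b
      simp only [passQubit, Pi.smul_apply, Finset.sum_apply]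
    rw [hlin, applyLocal_smul, applyLocal_sum]
    simp only [applyLocal_sum, applyLocal_basisState]
    congr 1
    rw [← Fintype.sum_prod_type_right (f := fun q : Fin 2 × (α → Fin 2) => basisState fun i => P i
      (((x i, view (fun a => s (some a)) (fun a => t (some a)) i q.2), fun _ => q.1),
        fun _ => q.1))]
    refine Finset.sum_equiv (Equiv.piOptionEquivProd (β := fun _ => Fin 2))
      (fun _ => by simp only [Finset.mem_univ]) fun y _ => ?_
    congr 1
    funext i
    refine Prod.ext rfl ?_
    funext o
    cases o with
    | none =>
      simp only [view, P, Option.elim_none, Equiv.piOptionEquivProd]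
      by_cases hs : i = s none
      · simp [hs]
      · by_cases ht : i = t none <;> simp [hs, ht, @eq_comm _ _ i]
    | some a => rfl

/-! ### Replacing a GHZ state by shared qubits -/

/-- The isometry `V` on a register and a share of a GHZ state, carried over to shared qubits:
the view `Z a` plays the part of `|a⟩`. All other views are kept, with output qubit `|0⟩`. -/
noncomputable def filteredMatrix {M Y W : Type} {r : ℕ} [DecidableEq M] [DecidableEq Y]
    (Z : Fin r → Y) (V : Matrix (Fin 2 × W) (M × Fin r) ℂ) :
    Matrix (Fin 2 × (W ⊕ (M × Y))) (M × Y) ℂ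
  | (o, Sum.inl w), b => ∑ a, if b.2 = Z a then V (o, w) (b.1, a) else 0
  | (o, Sum.inr b'), b => if o = 0 ∧ b' = b ∧ ∀ a, b.2 ≠ Z a then 1 else 0

theorem filteredMatrix_inl {M Y W : Type} {r : ℕ} [DecidableEq M] [DecidableEq Y]
    {Z : Fin r → Y} (hZ : Function.Injective Z) (V : Matrix (Fin 2 × W) (M × Fin r) ℂ)
    (o : Fin 2) (w : W) (x : M) (a : Fin r) :
    filteredMatrix Z V (o, Sum.inl w) (x, Z a) = V (o, w) (x, a) := by
  simp [filteredMatrix, hZ.eq_iff]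

theorem filteredMatrix_inl_of_forall_ne {M Y W : Type} {r : ℕ} [DecidableEq M] [DecidableEq Y]
    {Z : Fin r → Y} (V : Matrix (Fin 2 × W) (M × Fin r) ℂ)
    (o : Fin 2) (w : W) (x : M) {y : Y} (hy : ∀ a, y ≠ Z a) :
    filteredMatrix Z V (o, Sum.inl w) (x, y) = 0 := by
  simp [filteredMatrix, hy]

theorem filteredMatrix_isIsometry {M Y W : Type} {r : ℕ} [DecidableEq M] [DecidableEq Y]
    [Fintype M] [Fintype Y] [Fintype W] {Z : Fin r → Y} (hZ : Function.Injective Z)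
    {V : Matrix (Fin 2 × W) (M × Fin r) ℂ} (hV : IsIsometry V) :
    IsIsometry (filteredMatrix Z V) := by
  unfold IsIsometry at *
  ext ⟨x, y⟩ ⟨x', y'⟩
  rw [Matrix.mul_apply, Fintype.sum_prod_type]
  simp only [Fintype.sum_sum_type, Finset.sum_add_distrib, Matrix.conjTranspose_apply]
  by_cases hy : ∃ a, y = Z a
  · obtain ⟨a, rfl⟩ := hy
    have hr : ∀ o b, filteredMatrix Z V (o, Sum.inr b) (x, Z a) = 0 := fun o b =>
      if_neg fun h => h.2.2 a rfl
    simp only [filteredMatrix_inl hZ, hr, star_zero, zero_mul, Finset.sum_const_zero, add_zero]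
    by_cases hy' : ∃ a', y' = Z a'
    · obtain ⟨a', rfl⟩ := hy'
      have h := congrFun (congrFun hV (x, a)) (x', a')
      rw [Matrix.mul_apply, Fintype.sum_prod_type] at h
      simp only [filteredMatrix_inl hZ]
      refine h.trans ?_
      simp only [Matrix.one_apply, Prod.mk.injEq, hZ.eq_iff]
    · push Not at hy'
      simp only [filteredMatrix_inl_of_forall_ne V _ _ _ hy', mul_zero, Finset.sum_const_zero]
      rw [Matrix.one_apply_ne]
      exact fun h => hy' a (congrArg Prod.snd h).symm
  · push Not at hy
    simp only [filteredMatrix_inl_of_forall_ne V _ _ _ hy, star_zero, zero_mul,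
      Finset.sum_const_zero, zero_add]
    rw [Fin.sum_univ_two, Finset.sum_eq_single (x, y), Finset.sum_eq_zero, add_zero]
    · by_cases h : (x, y) = (x', y')
      · obtain ⟨rfl, rfl⟩ := Prod.mk.inj h
        simp [filteredMatrix, hy]
      · rw [Matrix.one_apply_ne h]
        simp only [Prod.mk.injEq] at h
        simp [filteredMatrix, h]
    · intro b _
      simp [filteredMatrix]
    · intro b _ hb
      simp [filteredMatrix, hb]
    · simp

/-- A GHZ protocol can be run on qubits shared along edges if the players can locally project
the bits on the edges onto a family `y` in which every player identifies the member. -/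
theorem messageComputable_of_locally_closed {k m r : ℕ} (hk : 1 ≤ k) {f : (Fin k → Fin m) → Bool}
    (hf : GHZComputable r f) (E : Type) [Fintype E] (s t : E → Fin k) (hst : ∀ e, s e ≠ t e)
    (y : Fin r → E → Fin 2)
    (hinj : ∀ i a b, (∀ e, s e = i ∨ t e = i → y a e = y b e) → a = b)
    (hclosed : ∀ z : E → Fin 2, (∀ i, ∃ a, ∀ e, s e = i ∨ t e = i → z e = y a e) →
      ∃ a, z = y a) :
    MessageComputable (Fintype.card E) f := by
  classical
  obtain ⟨W, hW, V, hV, hyes, hno⟩ := hf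
  obtain ⟨c, hc, h⟩ := exists_messagePassing_view (m := m) E s t hst
  let Z : Fin k → Fin r → E → Option (Fin 2) := fun i a => view s t i (y a)
  have hZ : ∀ i, Function.Injective (Z i) := fun i a b hab => hinj i a b (view_eq_iff.1 hab)
  have hy : Function.Injective y := fun a b hab => hinj ⟨0, hk⟩ a b fun e _ => by rw [hab]
  have h1 := MessagePassing.localOps (fun i => filteredMatrix (Z i) (V i))
    (fun i => filteredMatrix_isIsometry (hZ i) (hV i)) h
  -- what is left after the projection is the projected vector of the GHZ protocol, up to `c`
  have hinl : ∀ (x : Fin k → Fin m) (w : ∀ i, W i),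
      projOnes (applyLocal (fun i => filteredMatrix (Z i) (V i))
        (c • ∑ z : E → Fin 2, basisState (fun i => (x i, view s t i z))))
        (fun i => Sum.inl (w i)) = c * projOnes (applyLocal V (inputGHZ r x)) w := by
    intro x w
    rw [applyLocal_smul, applyLocal_sum, inputGHZ_eq_sum, applyLocal_sum]
    simp only [projOnes, Pi.smul_apply, Finset.sum_apply, applyLocal_basisState_apply, smul_eq_mul]
    congr 1
    symm
    refine Fintype.sum_of_injective y hy _ _ (fun z hz => ?_) (fun a => ?_)
    · have : ∃ i, ∀ a, view s t i z ≠ Z i a := by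
        by_contra hcon
        push Not at hcon
        obtain ⟨a, ha⟩ := hclosed z fun i => (hcon i).imp fun a ha => view_eq_iff.1 ha
        exact hz ⟨a, ha.symm⟩
      obtain ⟨i, hi⟩ := this
      exact Finset.prod_eq_zero (Finset.mem_univ i)
        (filteredMatrix_inl_of_forall_ne (V i) _ _ _ hi)
    · exact Finset.prod_congr rfl fun i _ => (filteredMatrix_inl (hZ i) (V i) _ _ _ a).symm
  have hinr : ∀ (x : Fin k → Fin m) (w : ∀ i, W i ⊕ (Fin m × (E → Option (Fin 2)))),
      (∃ i b, w i = Sum.inr b) →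
      projOnes (applyLocal (fun i => filteredMatrix (Z i) (V i))
        (c • ∑ z : E → Fin 2, basisState (fun i => (x i, view s t i z)))) w = 0 := by
    rintro x w ⟨i, b, hi⟩
    rw [applyLocal_smul, applyLocal_sum]
    simp only [projOnes, Pi.smul_apply, Finset.sum_apply, applyLocal_basisState_apply, smul_eq_mul]
    rw [Finset.sum_eq_zero, mul_zero]
    intro z _
    refine Finset.prod_eq_zero (Finset.mem_univ i) ?_
    rw [hi]
    simp [filteredMatrix]
  refine ⟨_, _, h1, fun x hx h0 => hyes x hx ?_, fun x hx => ?_⟩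
  · funext w
    have := hinl x w
    rw [h0, Pi.zero_apply] at this
    exact (mul_eq_zero.1 this.symm).resolve_left hc
  · funext w
    by_cases hw : ∃ i b, w i = Sum.inr b
    · exact hinr x w hw
    · have : ∀ i, ∃ u, w i = Sum.inl u := fun i => by
        cases hwi : w i with
        | inl u => exact ⟨u, rfl⟩
        | inr b => exact absurd ⟨i, b, hwi⟩ hw
      choose u hu using this
      rw [show w = fun i => Sum.inl (u i) from funext hu, hinl, hno x hx, Pi.zero_apply, mul_zero,
        Pi.zero_apply]

/-! ### Cyclic progressions -/

/-- The cyclic labels belonging to the vectors `u` and `v`: after `u` itself comes the arithmetic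
progression with initial term `v` and difference `u`. -/
def progression {n D : ℕ} (u v : Fin D → ℕ) : Fin (n + 2) → Fin D → ℕ :=
  Fin.cons u fun i d => v d + i * u d

/-- Every player can recover the whole progression from the two labels that he sees. -/
theorem progression_eq_of_adjacent {n D : ℕ} {u v u' v' : Fin D → ℕ} (i : Fin (n + 2))
    (h : progression u v i = progression u' v' i)
    (h' : progression u v (i + 1) = progression u' v' (i + 1)) : u = u' ∧ v = v' := by
  cases i using Fin.cases with
  | zero =>
    refine ⟨h, ?_⟩
    rw [zero_add, ← Fin.succ_zero_eq_one] at h'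
    simpa [progression] using h'
  | succ i =>
    have hv : u = u' → v = v' := by
      rintro rfl
      funext d
      have := congrFun h d
      simpa [progression] using this
    suffices u = u' from ⟨this, hv this⟩
    cases i using Fin.lastCases with
    | last =>
      simpa [progression] using h'
    | cast i =>
      rw [Fin.succ_castSucc, Fin.coeSucc_eq_succ] at h'
      funext d
      have h1 := congrFun h d
      have h2 := congrFun h' d
      simp only [progression, Fin.cons_succ, Fin.val_castSucc, Fin.val_succ] at h1 h2
      linarith

/-- A cyclic sequence of labels that looks to every player like a progression with prescribed
`|u|²` and `⟨u, v⟩` is such a progression. -/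
theorem exists_eq_progression {n D : ℕ} {ι : Type} (u v : ι → Fin D → ℕ) (c e : ℕ)
    (hc : ∀ a, ∑ d, u a d * u a d = c) (he : ∀ a, ∑ d, u a d * v a d = e)
    (z : Fin (n + 2) → Fin D → ℕ)
    (hz : ∀ i, ∃ a, z i = progression (u a) (v a) i ∧ z (i + 1) = progression (u a) (v a) (i + 1)) :
    ∃ a, z = progression (u a) (v a) := by
  obtain ⟨a, h0, h1⟩ := hz 0
  rw [zero_add, ← Fin.succ_zero_eq_one] at h1
  simp only [progression, Fin.cons_zero, Fin.cons_succ, zero_mul, add_zero,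
    Fin.coe_ofNat_eq_mod, Nat.zero_mod] at h0 h1
  -- the labels after the first one, as integral vectors
  let y : ℕ → Fin D → ℤ := fun i d => if h : i < n + 1 then (z (Fin.succ ⟨i, h⟩) d : ℤ) else 0
  have hy : ∀ i : Fin (n + 1), ∀ d, y i d = z i.succ d := fun i d => dif_pos i.2
  have hy0 : ∀ d, y 0 d = v a d := fun d => by
    rw [← congrFun h1 d]; exact hy 0 d
  have hstep : ∀ i < n, ∑ d, (y (i + 1) d - y i d) ^ 2 = (c : ℤ) := by
    intro i hi
    obtain ⟨b, hb, hb'⟩ := hz (Fin.succ (Fin.castSucc ⟨i, hi⟩))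
    rw [Fin.succ_castSucc, Fin.coeSucc_eq_succ] at hb'
    rw [← hc b]
    push_cast
    refine Finset.sum_congr rfl fun d _ => ?_
    have e1 := hy (Fin.castSucc ⟨i, hi⟩) d
    have e2 := hy (Fin.succ ⟨i, hi⟩) d
    rw [hb] at e1
    rw [hb'] at e2
    simp only [progression, Fin.cons_succ, Fin.val_castSucc, Fin.val_succ] at e1 e2
    rw [e1, e2]
    push_cast
    ring
  have hlast : ∑ d, (u a d : ℤ) * y n d = e + n * c := by
    obtain ⟨b, hb, hb'⟩ := hz (Fin.last n).succ
    have hub : u a = u b := by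
      rw [← h0]
      simpa [progression] using hb'
    rw [← he b, ← hc b]
    push_cast
    rw [Finset.mul_sum, ← Finset.sum_add_distrib]
    refine Finset.sum_congr rfl fun d _ => ?_
    have e1 := hy (Fin.last n) d
    rw [hb] at e1
    simp only [progression, Fin.cons_succ, Fin.val_last] at e1
    rw [e1, hub]
    push_cast
    ring
  -- the squared distances of the differences from `u` add up to zero
  have hsum : ∑ i ∈ Finset.range n, ∑ d, (y (i + 1) d - y i d - u a d) ^ 2 = 0 := by
    have hterm : ∀ i ∈ Finset.range n, ∑ d, (y (i + 1) d - y i d - u a d) ^ 2 =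
        (c + c : ℤ) - 2 * (∑ d, (u a d : ℤ) * y (i + 1) d - ∑ d, (u a d : ℤ) * y i d) := by
      intro i hi
      have hca : ∑ d, (u a d : ℤ) * u a d = c := by exact_mod_cast hc a
      nth_rw 1 [← hstep i (Finset.mem_range.1 hi), ← hca]
      rw [← Finset.sum_sub_distrib, Finset.mul_sum, ← Finset.sum_add_distrib,
        ← Finset.sum_sub_distrib]
      exact Finset.sum_congr rfl fun d _ => by ring
    have hea : ∑ d, (u a d : ℤ) * y 0 d = e := by
      simp only [hy0]
      exact_mod_cast he a
    rw [Finset.sum_congr rfl hterm, Finset.sum_sub_distrib, ← Finset.mul_sum,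
      Finset.sum_range_sub (fun i => ∑ d, (u a d : ℤ) * y i d), hlast, hea, Finset.sum_const,
      Finset.card_range, nsmul_eq_mul]
    ring
  have hdiff : ∀ i < n, ∀ d, y (i + 1) d = y i d + u a d := by
    intro i hi d
    rw [Finset.sum_eq_zero_iff_of_nonneg
      fun i _ => Finset.sum_nonneg fun d _ => sq_nonneg _] at hsum
    have h2 := hsum i (Finset.mem_range.2 hi)
    rw [Finset.sum_eq_zero_iff_of_nonneg fun d _ => sq_nonneg _] at h2
    have h3 := pow_eq_zero_iff two_ne_zero |>.1 (h2 d (Finset.mem_univ d))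
    linarith
  have hall : ∀ i ≤ n, ∀ d, y i d = v a d + i * u a d := by
    intro i
    induction i with
    | zero => intro _ d; simp [hy0]
    | succ i ih =>
      intro hi d
      rw [hdiff i hi, ih (by lia)]
      push_cast
      ring
  refine ⟨a, ?_⟩
  funext i
  cases i using Fin.cases with
  | zero => exact h0
  | succ i =>
    funext d
    have h2 := hall i (by lia) d
    rw [hy] at h2
    simp only [progression, Fin.cons_succ]
    exact_mod_cast h2

/-- Pigeonhole: many pairs of vectors agree in `|u|²` and `⟨u, v⟩`. -/
theorem exists_pairs_with_equal_products {D p r : ℕ}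
    (h : ((D + 1) * 4 ^ p) ^ 2 * r ≤ 4 ^ (p * D)) :
    ∃ (u v : Fin r → Fin D → Fin (2 ^ p)) (c e : ℕ),
      (∀ a b, u a = u b → v a = v b → a = b) ∧
      (∀ a, ∑ d, (u a d : ℕ) * (u a d : ℕ) = c) ∧ ∀ a, ∑ d, (u a d : ℕ) * (v a d : ℕ) = e := by
  have hlt : ∀ u v : Fin D → Fin (2 ^ p), ∑ d, (u d : ℕ) * (v d : ℕ) < (D + 1) * 4 ^ p := by
    intro u v
    have h4 : (4 : ℕ) ^ p = 2 ^ p * 2 ^ p := by rw [← mul_pow]; norm_num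
    calc ∑ d, (u d : ℕ) * (v d : ℕ) ≤ ∑ _d : Fin D, 4 ^ p :=
          Finset.sum_le_sum fun d _ => h4 ▸ Nat.mul_le_mul (u d).2.le (v d).2.le
      _ = D * 4 ^ p := by simp
      _ < (D + 1) * 4 ^ p := Nat.mul_lt_mul_of_pos_right (Nat.lt_succ_self D) (by positivity)
  let F : (Fin D → Fin (2 ^ p)) × (Fin D → Fin (2 ^ p)) →
      Fin ((D + 1) * 4 ^ p) × Fin ((D + 1) * 4 ^ p) :=
    fun w => (⟨_, hlt w.1 w.1⟩, ⟨_, hlt w.1 w.2⟩)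
  have : Nonempty (Fin ((D + 1) * 4 ^ p) × Fin ((D + 1) * 4 ^ p)) := by
    have : 0 < (D + 1) * 4 ^ p := by positivity
    exact ⟨(⟨0, this⟩, ⟨0, this⟩)⟩
  obtain ⟨q, hq⟩ := Fintype.exists_le_card_fiber_of_mul_le_card (n := r) F (by
    simp only [Fintype.card_prod, Fintype.card_fun, Fintype.card_fin, ← sq]
    refine h.trans (le_of_eq ?_)
    rw [← pow_mul, ← pow_mul, show (4 : ℕ) = 2 ^ 2 by norm_num, ← pow_mul]
    congr 1
    ring)
  obtain ⟨T, hT, hTr⟩ := Finset.exists_subset_card_eq hq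
  let g : Fin r ≃ T := (T.equivFinOfCardEq hTr).symm
  have hg : ∀ a, F (g a) = q := fun a => (Finset.mem_filter.1 (hT (g a).2)).2
  refine ⟨fun a => (g a).1.1, fun a => (g a).1.2, q.1, q.2, fun a b hu hv => ?_, fun a => ?_,
    fun a => ?_⟩
  · exact g.injective (Subtype.ext (Prod.ext hu hv))
  · rw [← hg a]
  · rw [← hg a]

/-! ### Choice of the parameters -/

open Filter in
/-- For large `ℓ`, vectors of length `D` with entries below `2 ^ p` yield `2 ^ ℓ` progressions,
while the labels, with `p + k` bits for an entry, cost little more than `k / 2 * ℓ` qubits. -/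
theorem exists_parameters (k : ℕ) (hk : 1 ≤ k) (ε : ℝ) (hε : 0 < ε) :
    ∃ n₀ : ℕ, ∀ ℓ : ℝ, n₀ < ℓ → ∃ p D : ℕ,
      ((k * (D * (p + k)) : ℕ) : ℝ) ≤ (k + ε) / 2 * ℓ ∧
      ℓ + 2 * Real.logb 2 (D + 1) + 4 * p ≤ 2 * (p * D) := by
  have hk0 : (0 : ℝ) < k := by exact_mod_cast hk
  obtain ⟨η, hη⟩ : ∃ η : ℝ, η = ε / k := ⟨_, rfl⟩
  have hη0 : 0 < η := hη ▸ div_pos hε hk0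
  have hkη : k * η = ε := by rw [hη]; field_simp
  -- this `p` makes `p / (p + k)`, the fraction of useful bits, at least `(1 + η / 2) / (1 + η)`
  obtain ⟨p, hp⟩ := exists_nat_ge (2 * k * (1 + η / 2) / η)
  rw [div_le_iff₀ hη0] at hp
  have hp0 : (0 : ℝ) ≤ p := p.cast_nonneg
  have hpk : (0 : ℝ) < 2 * (p + k) := by positivity
  have hrate : (1 + η / 2) * (2 * (p + k)) ≤ 2 * p * (1 + η) := by nlinarith
  -- the loss `2 * log₂ (D + 1) + 6 * p` is sublinear in `ℓ`
  have hlog : ∀ᶠ ℓ : ℝ in atTop,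
      2 * Real.logb 2 ((2 + η) * ℓ) + 6 * p ≤ η / 2 * ℓ := by
    have h1 := Real.isLittleO_log_id_atTop.bound
      (show 0 < η / 8 * Real.log 2 by have := Real.log_pos one_lt_two; positivity)
    filter_upwards [h1, eventually_ge_atTop 1,
      eventually_ge_atTop ((2 * Real.logb 2 (2 + η) + 6 * p) / (η / 4))] with ℓ h1 h2 h3
    rw [div_le_iff₀ (by positivity)] at h3
    have h5 : Real.log ℓ ≤ η / 8 * Real.log 2 * ℓ := by
      have := (le_abs_self _).trans h1
      rwa [id, Real.norm_eq_abs, abs_of_nonneg (by linarith)] at this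
    have h6 : Real.logb 2 ℓ ≤ η / 8 * ℓ := by
      rw [Real.logb, div_le_iff₀ (Real.log_pos one_lt_two)]
      linarith
    rw [Real.logb_mul (by positivity) (by positivity)]
    linarith
  obtain ⟨N, hN⟩ := eventually_atTop.1 (hlog.and (eventually_ge_atTop 1))
  obtain ⟨n₀, hn₀⟩ := exists_nat_ge N
  refine ⟨n₀, fun ℓ hℓ => ⟨p, ⌊(1 + η) * ℓ / (2 * (p + k))⌋₊, ?_⟩⟩
  obtain ⟨h1, h2⟩ := hN ℓ (hn₀.trans hℓ.le)
  have hx : 0 ≤ (1 + η) * ℓ / (2 * (p + k)) := by positivity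
  set D := ⌊(1 + η) * ℓ / (2 * (p + k))⌋₊ with hD
  have hDle : (D : ℝ) * (2 * (p + k)) ≤ (1 + η) * ℓ :=
    (le_div_iff₀ hpk).1 (Nat.floor_le hx)
  have hDge : (1 + η) * ℓ / (2 * (p + k)) ≤ D + 1 := (Nat.lt_floor_add_one _).le
  constructor
  · push_cast
    rw [← hkη]
    nlinarith
  · have hk1 : (1 : ℝ) ≤ k := by exact_mod_cast hk
    have hD0 : (0 : ℝ) ≤ D := D.cast_nonneg
    have h3 : (D : ℝ) + 1 ≤ (2 + η) * ℓ := by nlinarith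
    have h4 : Real.logb 2 (D + 1) ≤ Real.logb 2 ((2 + η) * ℓ) :=
      Real.logb_le_logb_of_le one_lt_two (by positivity) h3
    have h5 : (1 + η / 2) * ℓ ≤ 2 * p * (D + 1) := by
      calc (1 + η / 2) * ℓ = (1 + η / 2) * (2 * (p + k)) * ℓ / (2 * (p + k)) := by
            field_simp
        _ ≤ 2 * p * (1 + η) * ℓ / (2 * (p + k)) := by gcongr
        _ = 2 * p * ((1 + η) * ℓ / (2 * (p + k))) := by ring
        _ ≤ 2 * p * (D + 1) := by gcongr
    linarith

theorem parameters_to_nat {D p r : ℕ} (hr : 1 ≤ r)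
    (h : Real.logb 2 r + 2 * Real.logb 2 (D + 1) + 4 * p ≤ 2 * (p * D)) :
    ((D + 1) * 4 ^ p) ^ 2 * r ≤ 4 ^ (p * D) := by
  have hr0 : (0 : ℝ) < r := by exact_mod_cast hr
  have hD0 : (0 : ℝ) < D + 1 := by positivity
  have h2 := Real.rpow_le_rpow_of_exponent_le one_le_two h
  rw [Real.rpow_add two_pos, Real.rpow_add two_pos, Real.rpow_logb two_pos (by norm_num) hr0,
    two_mul (Real.logb 2 _), Real.rpow_add two_pos,
    Real.rpow_logb two_pos (by norm_num) hD0] at h2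
  have e1 : (2 : ℝ) ^ (4 * (p : ℝ)) = (4 ^ p) ^ 2 := by
    rw [show (4 : ℝ) * p = ((4 * p : ℕ) : ℝ) by push_cast; ring, Real.rpow_natCast, ← pow_mul,
      show (4 : ℝ) = 2 ^ 2 by norm_num, ← pow_mul]
    congr 1; ring
  have e2 : (2 : ℝ) ^ (2 * ((p : ℝ) * D)) = 4 ^ (p * D) := by
    rw [show (2 : ℝ) * (p * D) = ((2 * (p * D) : ℕ) : ℝ) by push_cast; ring, Real.rpow_natCast,
      show (4 : ℝ) = 2 ^ 2 by norm_num, ← pow_mul]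
  rw [e1, e2] at h2
  have : (((D + 1) * 4 ^ p) ^ 2 * r : ℝ) ≤ 4 ^ (p * D) := by linarith
  exact_mod_cast this

/-! ### The players in a cycle -/

/-- The progressions are written in binary on qubits shared in a cycle: those of the label `j` are
shared by the players `j` and `j - 1`, so that player `i` sees the labels `i` and `i + 1`. -/
theorem messageComputable_of_le {n m r p D : ℕ} {f : (Fin (n + 2) → Fin m) → Bool}
    (hf : GHZComputable r f) (h : ((D + 1) * 4 ^ p) ^ 2 * r ≤ 4 ^ (p * D)) :
    MessageComputable ((n + 2) * (D * (p + (n + 2)))) f := by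
  obtain ⟨u, v, c, e, huv, hc, he⟩ := exists_pairs_with_equal_products h
  have hlt : ∀ a j d, progression (n := n) (fun d => (u a d : ℕ)) (fun d => (v a d : ℕ)) j d <
      2 ^ (p + (n + 2)) := by
    intro a j d
    have hu := (u a d).2
    have hv := (v a d).2
    have hn : n + 2 < 2 ^ (n + 2) := Nat.lt_two_pow_self
    rw [pow_add]
    cases j using Fin.cases with
    | zero => simp only [progression, Fin.cons_zero]; nlinarith
    | succ i =>
      simp only [progression, Fin.cons_succ]
      have hi : (i : ℕ) ≤ n := by lia
      have := Nat.mul_le_mul hi hu.le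
      nlinarith
  -- `y a w` and `val` are the encoding of the `a`-th progression and the decoding of labels
  let y : Fin r → Fin (n + 2) × Fin D × Fin (p + (n + 2)) → Fin 2 := fun a w =>
    finFunctionFinEquiv.symm ⟨_, hlt a w.1 w.2.1⟩ w.2.2
  let val : (Fin (n + 2) × Fin D × Fin (p + (n + 2)) → Fin 2) → Fin (n + 2) → Fin D → ℕ :=
    fun z j d => (finFunctionFinEquiv fun b => z (j, d, b) : Fin (2 ^ (p + (n + 2))))
  have hval : ∀ a, val (y a) = progression (fun d => (u a d : ℕ)) (fun d => (v a d : ℕ)) :=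
    fun a => by
      funext j d
      exact congrArg Fin.val (finFunctionFinEquiv.apply_symm_apply ⟨_, hlt a j d⟩)
  have hvalinj : Function.Injective val := by
    intro z z' hz
    funext ⟨j, d, b⟩
    have := finFunctionFinEquiv.injective (Fin.ext (congrFun (congrFun hz j) d))
    exact congrFun this b
  have hloc : ∀ (i : Fin (n + 2)) z z',
      (∀ w : Fin (n + 2) × Fin D × Fin (p + (n + 2)), w.1 = i ∨ w.1 - 1 = i → z w = z' w) →
      val z i = val z' i ∧ val z (i + 1) = val z' (i + 1) := by
    intro i z z' hz
    constructor <;> funext d <;> simp only [val]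
    · rw [show (fun b => z (i, d, b)) = fun b => z' (i, d, b) from
        funext fun b => hz _ (Or.inl rfl)]
    · rw [show (fun b => z (i + 1, d, b)) = fun b => z' (i + 1, d, b) from
        funext fun b => hz _ (Or.inr (add_sub_cancel_right i 1))]
  have := messageComputable_of_locally_closed (Nat.le_add_left 1 (n + 1)) hf
    (Fin (n + 2) × Fin D × Fin (p + (n + 2))) (fun w => w.1) (fun w => w.1 - 1)
    (fun w hw => one_ne_zero (sub_eq_self.1 hw.symm)) y ?_ ?_
  · simpa using this
  · intro i a b hab
    obtain ⟨h1, h2⟩ := hloc i _ _ hab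
    rw [hval, hval] at h1 h2
    obtain ⟨hu, hv⟩ := progression_eq_of_adjacent i h1 h2
    exact huv a b (funext fun d => Fin.ext (congrFun hu d)) (funext fun d => Fin.ext (congrFun hv d))
  · intro z hz
    obtain ⟨a, ha⟩ := exists_eq_progression (fun a d => (u a d : ℕ)) (fun a d => (v a d : ℕ)) c e
      hc he (val z) fun i => (hz i).imp fun a ha => by
        rw [← hval a]
        exact hloc i _ _ ha
    exact ⟨a, hvalinj (ha.trans (hval a).symm)⟩

theorem messageComputable_zero_of_one_player {m : ℕ} (f : (Fin 1 → Fin m) → Bool) :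
    MessageComputable 0 f := by
  let Q : Fin m → Fin 2 × Fin m := fun b => (if f (fun _ => b) = true then 1 else 0, b)
  have hQ : Function.Injective Q := fun a b h => congrArg Prod.snd h
  have hacc : ∀ x, projOnes (applyLocal (fun _ : Fin 1 => basisMap Q) (basisState x)) ≠ 0 ↔
      f x = true := by
    intro x
    rw [applyLocal_basisState, projOnes_basisState]
    have hx : (fun _ => x 0) = x := funext fun i => by rw [Subsingleton.elim i 0]
    simp [Q, hx]
  refine ⟨_, _, MessagePassing.localOps (fun _ => basisMap Q) (fun _ => basisMap_isIsometry hQ)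
    MessagePassing.init, fun x hx => (hacc x).2 hx, fun x hx => ?_⟩
  by_contra h
  rw [(hacc x).1 h] at hx
  exact absurd hx (by simp)

end QComm

theorem mainTheorem4 (k : ℕ) (hk : 1 ≤ k) (ε : ℝ) (hε : 0 < ε) :
    ∃ n₀ : ℕ, ∀ (m : ℕ) (f : (Fin k → Fin m) → Bool), (n₀ : ℝ) < QComm.NQ f →
      (QComm.NQ₀ f : ℝ) ≤ ((k : ℝ) + ε) / 2 * QComm.NQ f := by
  obtain ⟨n₀, hn₀⟩ := QComm.exists_parameters k hk ε hε
  refine ⟨n₀, fun m f hf => ?_⟩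
  obtain ⟨p, D, hcost, hsize⟩ := hn₀ _ hf
  obtain ⟨hr, hghz⟩ := Nat.sInf_mem (QComm.exists_GHZComputable hk f)
  obtain rfl | ⟨n, rfl⟩ : k = 1 ∨ ∃ n, k = n + 2 := by
    rcases Nat.lt_or_ge 1 k with h | h
    · exact Or.inr ⟨k - 2, by lia⟩
    · exact Or.inl (by lia)
  · have h0 : QComm.NQ₀ f = 0 := Nat.le_zero.1 (Nat.sInf_le
      (QComm.messageComputable_zero_of_one_player f))
    rw [h0, Nat.cast_zero]
    exact (Nat.cast_nonneg _).trans hcost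
  · refine le_trans ?_ hcost
    exact_mod_cast Nat.sInf_le
      (QComm.messageComputable_of_le hghz (QComm.parameters_to_nat hr hsize))
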